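/- Consider the Ising channel with ternary alphabet $\mathcal X=\mathcal S=\mathcal Y=\{0,1,2\}$: if the channel is in state $s$ and the input is $x$, the output is $y=x$ with probability $1/2$ and $y=s$ with probability $1/2$ (so $y=x$ surely if $x=s$), independently of the past given $(x,s)$, and the new state is $s'=x$. The channel starts in a state $s_0$ known to encoder and decoder. A feedback code of block length $n$ with $M$ messages consists of encoding functions giving the input $x_t$ from the message and the past outputs $y_1,\dots,y_{t-1}$, for $1\le t\le n$, and a decoding function giving an estimate of the message from $y_1,\dots,y_n$ (all of these may depend on $s_0$). A rate $R$ is achievable if there are feedback codes of block length $n$ with $\lceil 2^{nR}\rceil$ messages, $n=0,1,2,\dots$, whose average error probability for a uniformly distributed message tends to $0$ as $n\to\infty$. The feedback capacity $C_{\mathrm{fb}}$ is the supremum of the achievable rates. Theorem. For every initial state $s_0$, the feedback capacity of the ternary Ising channel is $$C_{\mathrm{fb}}=\max_{p\in[0,1]}\frac{2\,\bigl(H_2(p)+1-p\bigr)}{p+3},$$ where $H_2(p)=-p\log_2 p-(1-p)\log_2(1-p)$ (with $0\log_2 0=0$). Moreover $|C_{\mathrm{fb}}-0.961227|\le 5\cdot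 10^{-7}$, and the maximum is attained at some $p$ with $|p-0.263805|\le 5\cdot 10^{-7}$. -/

import Mathlib

open Filter Topology

noncomputable section

/-- A unifilar finite-state channel with input alphabet `X`, state alphabet `S` and output
alphabet `Y`: `prob x s y` is `p(y | x, s)` and `next x y s` is the new state `f(x, y, s)`. -/
structure UnifilarFSC (X S Y : Type*) [Fintype Y] where
  prob : X → S → Y → ℝ
  prob_nonneg : ∀ x s y, 0 ≤ prob x s y
  prob_sum : ∀ x s, ∑ y, prob x s y = 1
  next : X → Y → S → S

namespace UnifilarFSC

variable {X S Y : Type*} [Fintype Y]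

/-- A feedback strategy: the input at time `t` (counted from `0`) as a function of the
previous outputs `y 0, …, y (t - 1)`. -/
abbrev Strategy (X Y : Type*) : Type _ := (t : ℕ) → (Fin t → Y) → X

/-- The channel state after `t` uses, when it starts in `s₀`, the inputs follow the strategy `f`,
and the outputs were `y`. -/
def stateAfter (ch : UnifilarFSC X S Y) (s₀ : S) (f : Strategy X Y) :
    (t : ℕ) → (Fin t → Y) → S
  | 0, _ => s₀
  | t + 1, y =>
      ch.next (f t (Fin.init y)) (y (Fin.last t)) (ch.stateAfter s₀ f t (Fin.init y))

/-- The probability that the first `t` outputs are `y`, when the channel starts in `s₀` and the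
inputs follow the strategy `f`. -/
def outputProb (ch : UnifilarFSC X S Y) (s₀ : S) (f : Strategy X Y) :
    (t : ℕ) → (Fin t → Y) → ℝ
  | 0, _ => 1
  | t + 1, y =>
      ch.outputProb s₀ f t (Fin.init y) *
        ch.prob (f t (Fin.init y)) (ch.stateAfter s₀ f t (Fin.init y)) (y (Fin.last t))

/-- A feedback code with `M` messages and block length `n`. Only the inputs at the times `t < n`
matter. The code may be chosen depending on the initial state, so the latter is known to
both the encoder and the decoder. -/
structure FeedbackCode (X Y : Type*) (M n : ℕ) where
  enc : Fin M → Strategy X Y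
  dec : (Fin n → Y) → Fin M

/-- The average probability of error, for a uniformly distributed message. -/
def errorProb (ch : UnifilarFSC X S Y) (s₀ : S) {M n : ℕ} (c : FeedbackCode X Y M n) : ℝ :=
  (∑ m : Fin M, ∑ y : Fin n → Y,
    if c.dec y = m then 0 else ch.outputProb s₀ (c.enc m) n y) / M

/-- The rate `R` (in bits per channel use) is achievable with feedback from the initial state `s₀`:
some codes with `⌈2 ^ (n R)⌉` messages and block length `n` have error probability tending to `0`. -/
def IsAchievable (ch : UnifilarFSC X S Y) (s₀ : S) (R : ℝ) : Prop :=
  ∃ c : (n : ℕ) → FeedbackCode X Y ⌈(2 : ℝ) ^ ((n : ℝ) * R)⌉₊ n,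
    Tendsto (fun n => ch.errorProb s₀ (c n)) atTop (𝓝 0)

/-- `C` is the feedback capacity from the initial state `s₀`: the supremum of the
achievable rates. -/
def IsFeedbackCapacity (ch : UnifilarFSC X S Y) (s₀ : S) (C : ℝ) : Prop :=
  IsLUB {R : ℝ | ch.IsAchievable s₀ R} C

/-- The Ising channel over the alphabet `A`: the output is the input `x` or the state `s`, with
probability `1 / 2` each, and the new state is the input. -/
def ising (A : Type*) [Fintype A] [DecidableEq A] : UnifilarFSC A A A where
  prob x s y := (1 / 2) * (if y = x then 1 else 0) + (1 / 2) * (if y = s then 1 else 0)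
  prob_nonneg x s y := by positivity
  prob_sum x s := by
    rw [Finset.sum_add_distrib, ← Finset.mul_sum, ← Finset.mul_sum]
    simp
    norm_num
  next x _ _ := x

end UnifilarFSC

/-- The binary entropy function in bits. -/
def binEntropyBits (p : ℝ) : ℝ := Real.binEntropy p / Real.log 2

/-- The function `2 (H₂(p) + 1 - p) / (p + 3)`. -/
def ising3Rate (p : ℝ) : ℝ := 2 * ((binEntropyBits p + 1 - p) / (p + 3))

end

/-!
Converse. For every distribution `Q` of the output sequence, the logarithm of the number of messages
is asymptotically at most the largest divergence from `Q` that a strategy can produce. We take for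
`Q` the output distribution of the optimal scheme, which is generated by a graph on what the decoder
knows about the state. The largest divergence is then the value of a dynamic program, and an
explicit solution of its Bellman inequality bounds it by `-log p / 2` per channel use, where `p` is
the critical point of the rate function.

Achievability. Make the alphabet a group and send a word of increments. If the state `r` is known to
the decoder and the increment `e` is to be sent, the input is `r + e`. An output other than `r`
reveals `e`; if the output is `r`, the input is repeated, and the next output reveals `e`. So
nothing is ever decoded wrongly, and an increment takes `2` channel uses if it is `0` and `3 / 2` on
average otherwise. For words of length `k` with `p * k` zeros the total time concentrates around
`k * (3 + p) / 2`, and counting these words gives the rate.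
-/

/-! ### The duality bound -/

section Divergence

variable {ι : Type*} [Fintype ι]

/-- The Kullback–Leibler divergence `D(P ‖ Q)`, in nats, of weights on a finite type. It is
meaningful only for positive `Q`, since `Real.log 0 = 0`. -/
noncomputable def divergence (P Q : ι → ℝ) : ℝ :=
  ∑ i, P i * (Real.log (P i) - Real.log (Q i))

theorem mul_add_sub_mul_exp_le_mul_log_sub_log {a b : ℝ} (ha : 0 ≤ a) (hb : 0 < b) (g : ℝ) :
    a * g + a - b * Real.exp g ≤ a * (Real.log a - Real.log b) := by
  rcases ha.eq_or_lt with rfl | ha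
  · simpa using mul_nonneg hb.le (Real.exp_pos g).le
  · have hlog : Real.log (b * Real.exp g / a) = Real.log b + g - Real.log a := by
      rw [Real.log_div (by positivity) ha.ne', Real.log_mul hb.ne' (Real.exp_pos g).ne',
        Real.log_exp]
    have hle := Real.log_le_sub_one_of_pos (show 0 < b * Real.exp g / a by positivity)
    calc a * g + a - b * Real.exp g
        = a * (g - (b * Real.exp g / a - 1)) := by field_simp; ring
      _ ≤ a * (Real.log a - Real.log b) := mul_le_mul_of_nonneg_left (by linarith) ha.le

/-- One half of the Donsker–Varadhan variational formula. -/
theorem sum_mul_add_sub_le_divergence {P Q : ι → ℝ} (hP : ∀ i, 0 ≤ P i) (hQ : ∀ i, 0 < Q i)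
    (g : ι → ℝ) :
    ∑ i, P i * g i + ∑ i, P i - ∑ i, Q i * Real.exp (g i) ≤ divergence P Q := by
  rw [← Finset.sum_add_distrib, ← Finset.sum_sub_distrib]
  exact Finset.sum_le_sum fun i _ =>
    mul_add_sub_mul_exp_le_mul_log_sub_log (hP i) (hQ i) (g i)

theorem sum_filter_mul_log_le_divergence {P Q : ι → ℝ} (hP : ∀ i, 0 ≤ P i) (hQ : ∀ i, 0 < Q i)
    (hPQ : ∑ i, P i = ∑ i, Q i) (E : ι → Prop) [DecidablePred E] {M : ℝ} (hM : 0 < M) :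
    (∑ i with E i, P i) * Real.log M - M * ∑ i with E i, Q i ≤ divergence P Q := by
  refine le_trans ?_
    (sum_mul_add_sub_le_divergence hP hQ fun i => if E i then Real.log M else 0)
  rw [hPQ, add_sub_assoc, ← Finset.sum_sub_distrib, Finset.sum_filter, Finset.sum_filter,
    Finset.sum_mul, Finset.mul_sum, ← Finset.sum_sub_distrib, ← Finset.sum_add_distrib]
  refine Finset.sum_le_sum fun i _ => ?_
  split_ifs
  · rw [Real.exp_log hM]
    linarith [hQ i]
  · simp

theorem binEntropy_le_crossEntropy {p x : ℝ} (hp0 : 0 < p) (hp1 : p < 1)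
    (hx : x ∈ Set.Icc (0 : ℝ) 1) :
    Real.binEntropy x ≤ -x * Real.log p - (1 - x) * Real.log (1 - p) := by
  have h₁ := mul_add_sub_mul_exp_le_mul_log_sub_log hx.1 hp0 0
  have h₂ := mul_add_sub_mul_exp_le_mul_log_sub_log (sub_nonneg.2 hx.2) (sub_pos.2 hp1) 0
  rw [Real.exp_zero] at h₁ h₂
  rw [Real.binEntropy, Real.log_inv, Real.log_inv]
  linarith

end Divergence

theorem sum_fin_succ_eq_sum_snoc {Y : Type*} [Fintype Y] {t : ℕ} (F : (Fin (t + 1) → Y) → ℝ) :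
    ∑ y, F y = ∑ y : Fin t → Y, ∑ a : Y, F (Fin.snoc y a) := by
  rw [← (Fin.snocEquiv (fun _ : Fin (t + 1) => Y)).sum_comp, Fintype.sum_prod_type,
    Finset.sum_comm]
  rfl

namespace UnifilarFSC

variable {X S Y : Type*} [Fintype Y] (ch : UnifilarFSC X S Y) (s₀ : S) (f : Strategy X Y)

theorem outputProb_nonneg : ∀ (t : ℕ) (y : Fin t → Y), 0 ≤ ch.outputProb s₀ f t y
  | 0, _ => zero_le_one
  | t + 1, _ => mul_nonneg (outputProb_nonneg t _) (ch.prob_nonneg _ _ _)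

theorem outputProb_snoc {t : ℕ} (y : Fin t → Y) (a : Y) :
    ch.outputProb s₀ f (t + 1) (Fin.snoc y a) =
      ch.outputProb s₀ f t y * ch.prob (f t y) (ch.stateAfter s₀ f t y) a := by
  simp [outputProb]

theorem stateAfter_snoc {t : ℕ} (y : Fin t → Y) (a : Y) :
    ch.stateAfter s₀ f (t + 1) (Fin.snoc y a) =
      ch.next (f t y) a (ch.stateAfter s₀ f t y) := by
  simp [stateAfter]

theorem sum_outputProb (n : ℕ) : ∑ y, ch.outputProb s₀ f n y = 1 := by
  induction n with
  | zero => simp [outputProb]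
  | succ n ih => simp only [sum_fin_succ_eq_sum_snoc, outputProb_snoc, ← Finset.mul_sum,
      ch.prob_sum, mul_one, ih]

theorem sum_outputProb_mul_le_of_supermartingale (F : (t : ℕ) → (Fin t → Y) → ℝ)
    (hF : ∀ t y, ch.outputProb s₀ f t y ≠ 0 →
      ∑ a, ch.prob (f t y) (ch.stateAfter s₀ f t y) a * F (t + 1) (Fin.snoc y a) ≤ F t y)
    (n : ℕ) : ∑ y, ch.outputProb s₀ f n y * F n y ≤ F 0 Fin.elim0 := by
  induction n with
  | zero => simp [outputProb, Subsingleton.elim (default : Fin 0 → Y) Fin.elim0]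
  | succ n ih =>
    refine le_trans ?_ ih
    simp only [sum_fin_succ_eq_sum_snoc, outputProb_snoc, mul_assoc, ← Finset.mul_sum]
    refine Finset.sum_le_sum fun y _ => ?_
    by_cases hy : ch.outputProb s₀ f n y = 0
    · simp [hy]
    · exact mul_le_mul_of_nonneg_left (hF n y hy) (ch.outputProb_nonneg s₀ f n y)

section Codes

variable {M n : ℕ} (c : FeedbackCode X Y M n)

theorem errorProb_nonneg : 0 ≤ ch.errorProb s₀ c := by
  refine div_nonneg (Finset.sum_nonneg fun m _ => Finset.sum_nonneg fun y _ => ?_) M.cast_nonneg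
  split_ifs
  · exact le_rfl
  · exact ch.outputProb_nonneg s₀ _ n y

theorem errorProb_le_of_forall (hM : 0 < M) {B : ℝ}
    (hB : ∀ m, ∑ y with c.dec y ≠ m, ch.outputProb s₀ (c.enc m) n y ≤ B) :
    ch.errorProb s₀ c ≤ B := by
  have hM' : (0 : ℝ) < M := Nat.cast_pos.2 hM
  simp only [Finset.sum_filter, ne_eq, ite_not] at hB
  rw [errorProb, div_le_iff₀ hM', mul_comm]
  simpa using Finset.sum_le_sum fun m (_ : m ∈ Finset.univ) => hB m

theorem sum_correct_eq_mul_one_sub_errorProb (hM : 0 < M) :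
    ∑ m, ∑ y with c.dec y = m, ch.outputProb s₀ (c.enc m) n y =
      M * (1 - ch.errorProb s₀ c) := by
  have hM' : (M : ℝ) ≠ 0 := Nat.cast_ne_zero.2 hM.ne'
  have hcorrect (m : Fin M) : ∑ y with c.dec y = m, ch.outputProb s₀ (c.enc m) n y =
      1 - ∑ y, if c.dec y = m then 0 else ch.outputProb s₀ (c.enc m) n y := by
    rw [← ch.sum_outputProb s₀ (c.enc m) n, Finset.sum_filter, ← Finset.sum_sub_distrib]
    refine Finset.sum_congr rfl fun y _ => ?_
    split_ifs <;> simp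
  rw [Finset.sum_congr rfl fun m _ => hcorrect m, Finset.sum_sub_distrib, errorProb, mul_sub,
    mul_div_cancel₀ _ hM']
  simp

variable {c} in
/-- Test the divergence against `log M` on the decoding region of each message: the regions are
disjoint, so that their `Q`-probabilities sum to `1`. -/
theorem one_sub_errorProb_mul_log_le (hM : 0 < M) {Q : (Fin n → Y) → ℝ} (hQ : ∀ y, 0 < Q y)
    (hQ_sum : ∑ y, Q y = 1) {K : ℝ} (hK : ∀ f, divergence (ch.outputProb s₀ f n) Q ≤ K) :
    (1 - ch.errorProb s₀ c) * Real.log M ≤ K + 1 := by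
  have hM' : (0 : ℝ) < M := Nat.cast_pos.2 hM
  have hmessage (m : Fin M) :
      (∑ y with c.dec y = m, ch.outputProb s₀ (c.enc m) n y) * Real.log M -
        M * ∑ y with c.dec y = m, Q y ≤ K :=
    (sum_filter_mul_log_le_divergence (ch.outputProb_nonneg s₀ _ n) hQ
      ((ch.sum_outputProb s₀ _ n).trans hQ_sum.symm) _ hM').trans (hK (c.enc m))
  have hQ_fibers : ∑ m, ∑ y with c.dec y = m, Q y = 1 := by
    rw [Finset.sum_fiberwise, hQ_sum]
  have hsum := Finset.sum_le_sum fun m (_ : m ∈ Finset.univ) => hmessage m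
  rw [Finset.sum_sub_distrib, ← Finset.sum_mul, ← Finset.mul_sum, hQ_fibers,
    ch.sum_correct_eq_mul_one_sub_errorProb s₀ c hM, Finset.sum_const, Finset.card_univ,
    Fintype.card_fin, nsmul_eq_mul] at hsum
  refine le_of_mul_le_mul_left ?_ hM'
  linarith

end Codes

variable {ch s₀}

theorem IsAchievable.le_div_log_two_of_divergence_le {R ρ B : ℝ} (hR : ch.IsAchievable s₀ R)
    (Q : (n : ℕ) → (Fin n → Y) → ℝ) (hQ : ∀ n y, 0 < Q n y) (hQ_sum : ∀ n, ∑ y, Q n y = 1)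
    (hdiv : ∀ n f, divergence (ch.outputProb s₀ f n) (Q n) ≤ n * ρ + B) :
    R ≤ ρ / Real.log 2 := by
  obtain ⟨c, hc⟩ := hR
  rw [le_div_iff₀ (Real.log_pos one_lt_two)]
  have hlim_left : Tendsto (fun n => (1 - ch.errorProb s₀ (c n)) * (R * Real.log 2)) atTop
      (𝓝 (R * Real.log 2)) := by
    simpa using (hc.const_sub 1).mul_const (R * Real.log 2)
  have hlim_right : Tendsto (fun n : ℕ => ρ + (B + 1) / n) atTop (𝓝 ρ) := by
    simpa using (tendsto_const_div_atTop_nhds_zero_nat (B + 1)).const_add ρ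
  refine le_of_tendsto_of_tendsto hlim_left hlim_right ?_
  filter_upwards [hc.eventually_lt_const one_pos, eventually_gt_atTop 0] with n herr hn
  have hn' : (0 : ℝ) < n := Nat.cast_pos.2 hn
  have hmessages : (0 : ℝ) < 2 ^ ((n : ℝ) * R) := by positivity
  have hlog : n * (R * Real.log 2) ≤ Real.log ⌈(2 : ℝ) ^ ((n : ℝ) * R)⌉₊ := by
    rw [← mul_assoc, ← Real.log_rpow two_pos]
    exact Real.log_le_log hmessages (Nat.le_ceil _)
  refine le_of_mul_le_mul_left ?_ hn'
  calc n * ((1 - ch.errorProb s₀ (c n)) * (R * Real.log 2))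
      = (1 - ch.errorProb s₀ (c n)) * (n * (R * Real.log 2)) := by ring
    _ ≤ (1 - ch.errorProb s₀ (c n)) * Real.log ⌈(2 : ℝ) ^ ((n : ℝ) * R)⌉₊ :=
        mul_le_mul_of_nonneg_left hlog (sub_nonneg.2 herr.le)
    _ ≤ n * ρ + B + 1 :=
        ch.one_sub_errorProb_mul_log_le s₀ (Nat.ceil_pos.2 hmessages) (hQ n) (hQ_sum n) (hdiv n)
    _ = n * (ρ + (B + 1) / n) := by field_simp; ring

theorem isAchievable_of_eventually [Nonempty X] {R : ℝ} {ε : ℕ → ℝ} (hε : Tendsto ε atTop (𝓝 0))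
    (hcodes : ∀ᶠ n : ℕ in atTop, ∃ c : FeedbackCode X Y ⌈(2 : ℝ) ^ ((n : ℝ) * R)⌉₊ n,
      ch.errorProb s₀ c ≤ ε n) :
    ch.IsAchievable s₀ R := by
  have (n : ℕ) : Nonempty (FeedbackCode X Y ⌈(2 : ℝ) ^ ((n : ℝ) * R)⌉₊ n) :=
    ⟨⟨fun _ _ _ => Classical.arbitrary X, fun _ => ⟨0, Nat.ceil_pos.2 (by positivity)⟩⟩⟩
  exact ⟨fun n => Classical.epsilon fun c => ch.errorProb s₀ c ≤ ε n,
    squeeze_zero' (Eventually.of_forall fun n => ch.errorProb_nonneg s₀ _)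
      (hcodes.mono fun n hn => Classical.epsilon_spec hn) hε⟩

section TestSource

variable {V : Type*}

/-- A test distribution on output sequences generated by a labelled graph, as in the duality bound
on the feedback capacity. It is encoded as a channel with a single input symbol, so that
`T.prob () v y` is the probability of the output `y` at the vertex `v`, and `T.next () y v` the
vertex reached from `v` along the edge labelled `y`. -/
abbrev TestSource (V Y : Type*) [Fintype Y] : Type _ := UnifilarFSC Unit V Y

/-- `ρ` and `h` satisfy the Bellman inequality of the dynamic program in which the strategy
maximizes the divergence (in nats per channel use) of the output distribution from that of `T`. -/
def BellmanBound (ch : UnifilarFSC X S Y) (T : TestSource V Y) (ρ : ℝ) (h : V → S → ℝ) : Prop :=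
  ∀ v x s, ∑ y, ch.prob x s y * (Real.log (ch.prob x s y) - Real.log (T.prob () v y) +
    h (T.next () y v) (ch.next x y s)) ≤ ρ + h v s

namespace TestSource

variable (T : TestSource V Y) (v₀ : V) (t : ℕ) (y : Fin t → Y)

/-- The probability that the test source emits the outputs `y` from the vertex `v₀`. -/
noncomputable def seqProb : ℝ := T.outputProb v₀ (fun _ _ => ()) t y

/-- The vertex that the test source reaches from `v₀` along the outputs `y`. -/
def vertexAfter : V := T.stateAfter v₀ (fun _ _ => ()) t y

variable {t} in
theorem seqProb_snoc (a : Y) :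
    T.seqProb v₀ (t + 1) (Fin.snoc y a) =
      T.seqProb v₀ t y * T.prob () (T.vertexAfter v₀ t y) a :=
  T.outputProb_snoc v₀ _ y a

variable {t} in
theorem vertexAfter_snoc (a : Y) :
    T.vertexAfter v₀ (t + 1) (Fin.snoc y a) = T.next () a (T.vertexAfter v₀ t y) :=
  T.stateAfter_snoc v₀ _ y a

variable {T} in
theorem seqProb_pos (hT : ∀ v y, 0 < T.prob () v y) :
    ∀ (t : ℕ) (y : Fin t → Y), 0 < T.seqProb v₀ t y
  | 0, _ => zero_lt_one
  | t + 1, _ => mul_pos (seqProb_pos hT t _) (hT _ _)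

end TestSource

variable {T : TestSource V Y} {ρ : ℝ} {h : V → S → ℝ}

/-- The accumulated log-likelihood ratio, compensated by `h` and by `ρ` per step, is a
supermartingale. -/
theorem BellmanBound.sum_outputProb_mul_le (hb : ch.BellmanBound T ρ h)
    (hT : ∀ v y, 0 < T.prob () v y) (v₀ : V) (n : ℕ) :
    ∑ y, ch.outputProb s₀ f n y * (Real.log (ch.outputProb s₀ f n y) -
      Real.log (T.seqProb v₀ n y) + h (T.vertexAfter v₀ n y) (ch.stateAfter s₀ f n y) - n * ρ) ≤
      h v₀ s₀ := by
  refine (ch.sum_outputProb_mul_le_of_supermartingale s₀ f (fun t y =>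
    Real.log (ch.outputProb s₀ f t y) - Real.log (T.seqProb v₀ t y) +
      h (T.vertexAfter v₀ t y) (ch.stateAfter s₀ f t y) - t * ρ) (fun t y hy => ?_) n).trans ?_
  · set x := f t y
    set s := ch.stateAfter s₀ f t y
    set v := T.vertexAfter v₀ t y
    set past := Real.log (ch.outputProb s₀ f t y) - Real.log (T.seqProb v₀ t y)
    calc ∑ a, ch.prob x s a * (Real.log (ch.outputProb s₀ f (t + 1) (Fin.snoc y a)) -
          Real.log (T.seqProb v₀ (t + 1) (Fin.snoc y a)) +
          h (T.vertexAfter v₀ (t + 1) (Fin.snoc y a))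
            (ch.stateAfter s₀ f (t + 1) (Fin.snoc y a)) - (t + 1 : ℕ) * ρ)
        = ∑ a, (ch.prob x s a * (past - (t + 1) * ρ) + ch.prob x s a *
          (Real.log (ch.prob x s a) - Real.log (T.prob () v a) +
            h (T.next () a v) (ch.next x a s))) := by
          refine Finset.sum_congr rfl fun a _ => ?_
          by_cases ha : ch.prob x s a = 0
          · simp [ha]
          rw [outputProb_snoc, TestSource.seqProb_snoc, TestSource.vertexAfter_snoc,
            stateAfter_snoc, Real.log_mul hy ha,
            Real.log_mul (TestSource.seqProb_pos v₀ hT t y).ne' (hT _ a).ne']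
          push_cast
          ring
      _ ≤ past + h v s - t * ρ := by
          rw [Finset.sum_add_distrib, ← Finset.sum_mul, ch.prob_sum]
          linarith [hb v x s]
  · simp [outputProb, TestSource.seqProb, TestSource.vertexAfter, stateAfter]

theorem BellmanBound.divergence_le (hb : ch.BellmanBound T ρ h) (hT : ∀ v y, 0 < T.prob () v y)
    {B : ℝ} (hB : ∀ v s, B ≤ h v s) (v₀ : V) (n : ℕ) :
    divergence (ch.outputProb s₀ f n) (T.seqProb v₀ n) ≤ n * ρ + (h v₀ s₀ - B) := by
  have hcompensated : divergence (ch.outputProb s₀ f n) (T.seqProb v₀ n) +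
      (∑ y, ch.outputProb s₀ f n y) * (B - n * ρ) ≤ h v₀ s₀ := by
    refine le_trans ?_ (hb.sum_outputProb_mul_le (s₀ := s₀) f hT v₀ n)
    rw [divergence, Finset.sum_mul, ← Finset.sum_add_distrib]
    refine Finset.sum_le_sum fun y _ => ?_
    rw [← mul_add]
    refine mul_le_mul_of_nonneg_left ?_ (ch.outputProb_nonneg s₀ f n y)
    linarith [hB (T.vertexAfter v₀ n y) (ch.stateAfter s₀ f n y)]
  rw [sum_outputProb] at hcompensated
  linarith

theorem IsAchievable.le_div_log_two_of_bellmanBound {R B : ℝ} (hR : ch.IsAchievable s₀ R)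
    (hb : ch.BellmanBound T ρ h) (hT : ∀ v y, 0 < T.prob () v y) (hB : ∀ v s, B ≤ h v s)
    (v₀ : V) : R ≤ ρ / Real.log 2 :=
  hR.le_div_log_two_of_divergence_le (T.seqProb v₀) (TestSource.seqProb_pos v₀ hT)
    (fun n => T.sum_outputProb v₀ _ n) (fun n f => hb.divergence_le f hT hB v₀ n)

end TestSource

end UnifilarFSC

/-! ### The rate function -/

/-- The rate `2 (H₂(p) + (1 - p) log₂ (q - 1)) / (p + 3)` for the Ising channel with `q` symbols. -/
noncomputable def isingRate (q p : ℝ) : ℝ :=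
  2 * ((binEntropyBits p + (1 - p) * Real.logb 2 (q - 1)) / (p + 3))

theorem isingRate_three : isingRate 3 = ising3Rate := by
  funext p
  norm_num [isingRate, ising3Rate, add_sub_assoc]

theorem isingRate_eq_div_log_two (q p : ℝ) :
    isingRate q p =
      2 * (Real.binEntropy p + (1 - p) * Real.log (q - 1)) / (p + 3) / Real.log 2 := by
  rw [isingRate, binEntropyBits, Real.logb]
  ring

theorem isingRate_pos {q p : ℝ} (hq : 2 ≤ q) (hp0 : 0 < p) (hp1 : p < 1) : 0 < isingRate q p := by
  have hentropy : 0 < Real.binEntropy p := Real.binEntropy_pos hp0 hp1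
  have hlogq : 0 ≤ (1 - p) * Real.log (q - 1) :=
    mul_nonneg (by linarith) (Real.log_nonneg (by linarith))
  rw [isingRate_eq_div_log_two]
  positivity

/-- `p` is a critical point of `isingRate q` in `(0, 1)`: after exponentiation, the equation
`d/dp isingRate q p = 0` becomes polynomial. -/
structure IsOptimalParam (q p : ℝ) : Prop where
  pos : 0 < p
  lt_one : p < 1
  eq : (q - 1) ^ 4 * p ^ 3 = (1 - p) ^ 4

theorem exists_isOptimalParam {q : ℝ} (hq : q ≠ 1) : ∃ p, IsOptimalParam q p := by
  have hcont : ContinuousOn (fun p : ℝ => (q - 1) ^ 4 * p ^ 3 - (1 - p) ^ 4) (Set.Icc 0 1) := by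
    fun_prop
  have hq' : 0 < (q - 1) ^ 4 := by have := sub_ne_zero.2 hq; positivity
  obtain ⟨p, ⟨hp0, hp1⟩, hp⟩ := intermediate_value_Ioo zero_le_one hcont
    (show (0 : ℝ) ∈ Set.Ioo _ _ by constructor <;> norm_num [hq'])
  exact ⟨p, hp0, hp1, sub_eq_zero.1 hp⟩

namespace IsOptimalParam

variable {q p : ℝ}

theorem log_one_sub (hp : IsOptimalParam q p) :
    Real.log (1 - p) = Real.log (q - 1) + 3 / 4 * Real.log p := by
  have hp3 : p ^ 3 ≠ 0 := pow_ne_zero 3 hp.pos.ne'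
  have hq : (q - 1) ^ 4 ≠ 0 := by
    refine left_ne_zero_of_mul (b := p ^ 3) ?_
    rw [hp.eq]
    exact pow_ne_zero 4 (sub_pos.2 hp.lt_one).ne'
  have hlog := congrArg Real.log hp.eq
  rw [Real.log_mul hq hp3, Real.log_pow, Real.log_pow, Real.log_pow] at hlog
  push_cast at hlog
  linarith

theorem isingRate_eq (hp : IsOptimalParam q p) : isingRate q p = -Real.log p / 2 / Real.log 2 := by
  rw [isingRate_eq_div_log_two, Real.binEntropy, Real.log_inv, Real.log_inv, hp.log_one_sub]
  congr 1
  rw [div_eq_iff (by linarith [hp.pos])]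
  ring

theorem isingRate_le (hp : IsOptimalParam q p) {x : ℝ} (hx : x ∈ Set.Icc (0 : ℝ) 1) :
    isingRate q x ≤ isingRate q p := by
  have hgibbs := binEntropy_le_crossEntropy hp.pos hp.lt_one hx
  rw [hp.log_one_sub] at hgibbs
  rw [hp.isingRate_eq, isingRate_eq_div_log_two]
  refine div_le_div_of_nonneg_right ?_ (Real.log_pos one_lt_two).le
  rw [div_le_iff₀ (by linarith [hx.1])]
  linarith

theorem isGreatest (hp : IsOptimalParam q p) :
    IsGreatest (isingRate q '' Set.Icc 0 1) (isingRate q p) :=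
  ⟨⟨p, ⟨hp.pos.le, hp.lt_one.le⟩, rfl⟩, by rintro _ ⟨x, hx, rfl⟩; exact hp.isingRate_le hx⟩

theorem lt_of_mul_pow_lt (hp : IsOptimalParam q p) {a : ℝ} (ha : a ≤ 1)
    (h : (q - 1) ^ 4 * a ^ 3 < (1 - a) ^ 4) : a < p := by
  by_contra! hpa
  have := hp.pos
  refine h.not_ge ?_
  calc (1 - a) ^ 4 ≤ (1 - p) ^ 4 := by gcongr
    _ = (q - 1) ^ 4 * p ^ 3 := hp.eq.symm
    _ ≤ (q - 1) ^ 4 * a ^ 3 := by gcongr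

theorem lt_of_lt_mul_pow (hp : IsOptimalParam q p) {a : ℝ} (ha : 0 ≤ a)
    (h : (1 - a) ^ 4 < (q - 1) ^ 4 * a ^ 3) : p < a := by
  by_contra! hap
  have := hp.lt_one
  refine h.not_ge ?_
  calc (q - 1) ^ 4 * a ^ 3 ≤ (q - 1) ^ 4 * p ^ 3 := by gcongr
    _ = (1 - p) ^ 4 := hp.eq
    _ ≤ (1 - a) ^ 4 := by gcongr

theorem one_div_sixteen_lt (hp : IsOptimalParam q p) (hq1 : 1 ≤ q) (hq8 : q ≤ 8) : 1 / 16 < p := by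
  refine hp.lt_of_mul_pow_lt (by norm_num) ?_
  calc (q - 1) ^ 4 * (1 / 16) ^ 3 ≤ 7 ^ 4 * (1 / 16) ^ 3 := by gcongr; linarith
    _ < (1 - 1 / 16) ^ 4 := by norm_num

end IsOptimalParam

theorem log_four_mul_mem_Icc {p : ℝ} (hp : p ∈ Set.Icc 0.26380532 0.26380534) :
    Real.log (4 * p) ∈ Set.Icc 0.0537504 0.0537506 := by
  obtain ⟨hlo, hhi⟩ := hp
  have hp0 : 0 < p := lt_of_lt_of_le (by norm_num) hlo
  -- the power series of `log (1 - x)` at the two values of `x = 1 - 4 p`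
  have hseries_lo := Real.abs_log_sub_add_sum_range_le (x := 1 - 4 * 0.26380532)
    (by rw [abs_lt]; constructor <;> norm_num) 6
  have hseries_hi := Real.abs_log_sub_add_sum_range_le (x := 1 - 4 * 0.26380534)
    (by rw [abs_lt]; constructor <;> norm_num) 6
  rw [sub_sub_cancel, abs_le] at hseries_lo hseries_hi
  constructor
  · refine le_trans ?_ (Real.log_le_log (by norm_num) (mul_le_mul_of_nonneg_left hlo zero_le_four))
    norm_num [Finset.sum_range_succ, abs_of_neg] at hseries_lo ⊢
    linarith [hseries_lo.1]
  · refine (Real.log_le_log (by positivity) (mul_le_mul_of_nonneg_left hhi zero_le_four)).trans ?_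
    norm_num [Finset.sum_range_succ, abs_of_neg] at hseries_hi ⊢
    linarith [hseries_hi.2]

namespace IsOptimalParam

variable {p : ℝ}

theorem mem_Ioo_of_three (hp : IsOptimalParam 3 p) : p ∈ Set.Ioo 0.26380532 0.26380534 :=
  ⟨hp.lt_of_mul_pow_lt (by norm_num) (by norm_num),
    hp.lt_of_lt_mul_pow (by norm_num) (by norm_num)⟩

theorem abs_sub_le_of_three (hp : IsOptimalParam 3 p) : |p - 0.263805| ≤ 5e-7 := by
  obtain ⟨hlo, hhi⟩ := hp.mem_Ioo_of_three
  rw [abs_sub_le_iff]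
  constructor <;> linarith

theorem abs_ising3Rate_sub_le (hp : IsOptimalParam 3 p) : |ising3Rate p - 0.961227| ≤ 5e-7 := by
  obtain ⟨hlo, hhi⟩ := log_four_mul_mem_Icc (Set.Ioo_subset_Icc_self hp.mem_Ioo_of_three)
  have hlog2_lo := Real.log_two_gt_d9
  have hlog2_hi := Real.log_two_lt_d9
  have hlog2 : 0 < Real.log 2 := by linarith
  rw [Real.log_mul four_ne_zero hp.pos.ne', show (4 : ℝ) = 2 ^ 2 by norm_num, Real.log_pow,
    Nat.cast_two] at hlo hhi
  rw [← isingRate_three, hp.isingRate_eq, abs_sub_le_iff, sub_le_iff_le_add, sub_le_comm,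
    div_le_iff₀ hlog2, le_div_iff₀ hlog2]
  constructor <;> linarith

end IsOptimalParam

/-! ### The converse for the Ising channel -/

theorem sum_ite_eq_add_card_sub_one_mul {A : Type*} [Fintype A] [DecidableEq A] (r : A)
    (a b : ℝ) : ∑ y, (if y = r then a else b) = a + ((Fintype.card A : ℝ) - 1) * b := by
  have hsplit (y : A) : (if y = r then a else b) = (if y = r then a - b else 0) + b := by
    split_ifs <;> ring
  simp only [hsplit, Finset.sum_add_distrib, Finset.sum_ite_eq', Finset.mem_univ, if_true,
    Finset.sum_const, Finset.card_univ, nsmul_eq_mul]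
  ring

theorem card_sub_one_pos {A : Type*} [Fintype A] [Nontrivial A] : (0 : ℝ) < Fintype.card A - 1 :=
  sub_pos.2 (Nat.one_lt_cast.2 Fintype.one_lt_card)

namespace UnifilarFSC

/-- What the outputs reveal about the state of the Ising channel, if the encoder repeats each input
that the decoder could not distinguish from the state. In `known r` the state is `r`. In
`ambiguous r` the previous state and the last output were both `r`, so that the last input, which
is now the state, is still undetermined. -/
inductive IsingBelief (A : Type*)
  | known (r : A)
  | ambiguous (r : A)

section Ising

variable {A : Type*} [Fintype A] [DecidableEq A]

theorem sum_ising_prob_mul (x s : A) (F : A → ℝ) :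
    ∑ y, (ising A).prob x s y * F y = (F x + F s) / 2 := by
  simp only [ising, add_mul, Finset.sum_add_distrib, mul_assoc, ← Finset.mul_sum, ite_mul, one_mul,
    zero_mul, Finset.sum_ite_eq', Finset.mem_univ, if_true]
  ring

theorem eq_or_eq_of_ising_prob_ne_zero {x s y : A} (h : (ising A).prob x s y ≠ 0) :
    y = x ∨ y = s := by
  by_contra! hy
  simp [ising, hy.1, hy.2] at h

theorem ising_prob_input (x s : A) : (ising A).prob x s x = if x = s then 1 else 1 / 2 := by
  simp only [ising, if_true]
  split_ifs <;> norm_num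

theorem ising_prob_state (x s : A) : (ising A).prob x s s = if x = s then 1 else 1 / 2 := by
  simp only [ising, if_true, eq_comm (a := s)]
  split_ifs <;> norm_num

end Ising

namespace IsingBelief

variable {A : Type*} [DecidableEq A]

/-- The belief after the output `y`. -/
def step : IsingBelief A → A → IsingBelief A
  | known r, y => if y = r then ambiguous r else known y
  | ambiguous _, y => known y

/-- The distribution of the next output at a belief, when the encoder repeats the known state with
probability `p` and otherwise sends one of the other symbols uniformly. -/
noncomputable def testProb [Fintype A] (p : ℝ) : IsingBelief A → A → ℝ
  | known r, y => if y = r then (1 + p) / 2 else (1 - p) / (2 * (Fintype.card A - 1))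
  | ambiguous r, y =>
      if y = r then 2 * p / (1 + p) else (1 - p) / ((1 + p) * (Fintype.card A - 1))

/-- The relative value of the channel state `s` at a belief, in the dynamic program that maximizes
the divergence from `testProb p`. -/
noncomputable def value (p : ℝ) : IsingBelief A → A → ℝ
  | known r, s => if s = r then 0 else Real.log 2 - Real.log p / 4
  | ambiguous r, s =>
      if s = r then -Real.log p / 2 + Real.log (1 + p) - Real.log 2
      else -Real.log p / 4 + Real.log (1 + p)

theorem neg_log_two_le_value {p : ℝ} (hp0 : 0 < p) (hp1 : p < 1) (v : IsingBelief A) (s : A) :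
    -Real.log 2 ≤ value p v s := by
  have hlog2 : 0 < Real.log 2 := Real.log_pos one_lt_two
  have hlogp : Real.log p < 0 := Real.log_neg hp0 hp1
  have hlogp' : 0 < Real.log (1 + p) := Real.log_pos (by linarith)
  cases v <;> simp only [value] <;> split_ifs <;> linarith

variable [Fintype A] [Nontrivial A]

theorem testProb_pos {p : ℝ} (hp0 : 0 < p) (hp1 : p < 1) (v : IsingBelief A) (y : A) :
    0 < testProb p v y := by
  have := card_sub_one_pos (A := A)
  have := sub_pos.2 hp1
  cases v <;> simp only [testProb] <;> split_ifs <;> positivity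

theorem sum_testProb {p : ℝ} (hp0 : 0 < p) (v : IsingBelief A) : ∑ y, testProb p v y = 1 := by
  have := card_sub_one_pos (A := A)
  cases v <;> simp only [testProb, sum_ite_eq_add_card_sub_one_mul] <;> field_simp <;> ring

/-- The test distribution on output sequences of the Ising channel. -/
noncomputable def testSource (A : Type*) [DecidableEq A] [Fintype A] [Nontrivial A] {p : ℝ}
    (hp0 : 0 < p) (hp1 : p < 1) : TestSource (IsingBelief A) A where
  prob _ := testProb p
  prob_nonneg _ v y := (testProb_pos hp0 hp1 v y).le
  prob_sum _ v := sum_testProb hp0 v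
  next _ y v := v.step y

variable {p : ℝ}

theorem log_testProb_known (hp : IsOptimalParam (Fintype.card A) p) (r y : A) :
    Real.log (testProb p (known r) y) =
      if y = r then Real.log (1 + p) - Real.log 2 else 3 / 4 * Real.log p - Real.log 2 := by
  have := hp.pos
  have hq := (card_sub_one_pos (A := A)).ne'
  have h1p := (sub_pos.2 hp.lt_one).ne'
  simp only [testProb]
  split_ifs
  · rw [Real.log_div (by positivity) two_ne_zero]
  · rw [Real.log_div h1p (by positivity), Real.log_mul two_ne_zero hq, hp.log_one_sub]
    ring

theorem log_testProb_ambiguous (hp : IsOptimalParam (Fintype.card A) p) (r y : A) :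
    Real.log (testProb p (ambiguous r) y) =
      if y = r then Real.log 2 + Real.log p - Real.log (1 + p)
      else 3 / 4 * Real.log p - Real.log (1 + p) := by
  have hp0 := hp.pos
  have hq := (card_sub_one_pos (A := A)).ne'
  have h1p := (sub_pos.2 hp.lt_one).ne'
  have hp1 : 1 + p ≠ 0 := by positivity
  simp only [testProb]
  split_ifs
  · rw [Real.log_div (by positivity) hp1, Real.log_mul two_ne_zero hp0.ne']
  · rw [Real.log_div h1p (by positivity), Real.log_mul hp1 hq, hp.log_one_sub]
    ring

/-- The constant `1 / 16` comes from the case in which `x`, `s` and the symbol of the belief are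
pairwise distinct, which reads `-4 * log 2 ≤ log p`. -/
theorem bellmanBound_testSource (hp : IsOptimalParam (Fintype.card A) p) (hp16 : 1 / 16 ≤ p) :
    (ising A).BellmanBound (testSource A hp.pos hp.lt_one) (-Real.log p / 2) (value p) := by
  have hlog2 : 0 < Real.log 2 := Real.log_pos one_lt_two
  have hlogp : -(4 * Real.log 2) ≤ Real.log p := by
    have h := Real.log_le_log (by norm_num) hp16
    rwa [show (1 / 16 : ℝ) = (2 ^ 4)⁻¹ by norm_num, Real.log_inv, Real.log_pow] at h
  intro v x s
  rw [sum_ising_prob_mul, ising_prob_input, ising_prob_state]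
  cases v with
  | known r =>
    simp only [testSource, ising, log_testProb_known hp, step, value]
    by_cases hxs : x = s <;> by_cases hxr : x = r <;> by_cases hsr : s = r <;> simp_all
    all_goals linarith
  | ambiguous r =>
    simp only [testSource, ising, log_testProb_ambiguous hp, step, value]
    by_cases hxs : x = s <;> by_cases hxr : x = r <;> by_cases hsr : s = r <;> simp_all
    all_goals linarith

end IsingBelief

theorem IsAchievable.le_isingRate {A : Type*} [Fintype A] [DecidableEq A] [Nontrivial A]
    (hA : Fintype.card A ≤ 8) {p : ℝ} (hp : IsOptimalParam (Fintype.card A) p) {s₀ : A} {R : ℝ}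
    (hR : (ising A).IsAchievable s₀ R) : R ≤ isingRate (Fintype.card A) p := by
  have hp16 := hp.one_div_sixteen_lt (by exact_mod_cast Fintype.card_pos (α := A))
    (by exact_mod_cast hA)
  rw [hp.isingRate_eq]
  exact hR.le_div_log_two_of_bellmanBound (IsingBelief.bellmanBound_testSource hp hp16.le)
    (IsingBelief.testProb_pos hp.pos hp.lt_one)
    (IsingBelief.neg_log_two_le_value hp.pos hp.lt_one) (.known s₀)

end UnifilarFSC

/-! ### The zero-error scheme -/

namespace UnifilarFSC

namespace IsingBelief

variable {A : Type*}

/-- The symbol `r` of `known r` and `ambiguous r`, relative to which the increments of the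
coding scheme are sent. -/
def base : IsingBelief A → A
  | known r => r
  | ambiguous r => r

section Decoder

variable [AddGroup A] [DecidableEq A]

/-- The increment that the decoder reads off the output `y`, if any. -/
def emit : IsingBelief A → A → List A
  | known r, y => if y = r then [] else [-r + y]
  | ambiguous r, y => [-r + y]

/-- The belief and the list of decoded increments after the outputs `y`, in the zero-error scheme
in which the encoder sends `base + e` for the next increment `e`, and sends it again when the
output leaves it undetermined. -/
def decode (s₀ : A) : (t : ℕ) → (Fin t → A) → IsingBelief A × List A
  | 0, _ => (known s₀, [])
  | t + 1, y =>
      let v := decode s₀ t (Fin.init y)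
      (v.1.step (y (Fin.last t)), v.2 ++ v.1.emit (y (Fin.last t)))

theorem decode_snoc (s₀ : A) {t : ℕ} (y : Fin t → A) (a : A) :
    decode s₀ (t + 1) (Fin.snoc y a : Fin (t + 1) → A) =
      ((decode s₀ t y).1.step a, (decode s₀ t y).2 ++ (decode s₀ t y).1.emit a) := by
  simp only [decode, Fin.init_snoc, Fin.snoc_last]

/-- The encoder of the zero-error scheme for the sequence `d` of increments. -/
def send (s₀ : A) (d : ℕ → A) : Strategy A A := fun t y =>
  (decode s₀ t y).1.base + d (decode s₀ t y).2.length

/-- The channel state at a belief, when the increment being sent is `e`. -/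
def stateOf (e : A) : IsingBelief A → A
  | known r => r
  | ambiguous r => r + e

theorem emit_step_eq_or (v : IsingBelief A) {e a : A} (ha : a = v.base + e ∨ a = v.stateOf e) :
    (v.emit a = [e] ∧ v.step a = known (v.base + e)) ∨
      (v.emit a = [] ∧ v.step a = ambiguous v.base) := by
  cases v with
  | known r =>
    by_cases har : a = r
    · exact .inr (by simp [emit, step, base, har])
    · obtain rfl : a = r + e := ha.resolve_right har
      exact .inl (by simp_all [emit, step, base])
  | ambiguous r =>
    obtain rfl : a = r + e := ha.elim id id
    exact .inl (by simp [emit, step, base])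

variable [Fintype A]

/-- On outputs of positive probability nothing is decoded wrongly: the randomness of the channel
only affects how many increments have been decoded. -/
theorem decode_send (s₀ : A) (d : ℕ → A) (t : ℕ) (y : Fin t → A)
    (hy : (ising A).outputProb s₀ (send s₀ d) t y ≠ 0) :
    (decode s₀ t y).2 = (List.range (decode s₀ t y).2.length).map d ∧
      (ising A).stateAfter s₀ (send s₀ d) t y =
        (decode s₀ t y).1.stateOf (d (decode s₀ t y).2.length) := by
  induction t with
  | zero => simp [decode, stateAfter, stateOf]
  | succ t ih =>
    cases y using Fin.snocCases with
    | snoc y a =>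
      rw [outputProb_snoc] at hy
      obtain ⟨hlist, hstate⟩ := ih y (left_ne_zero_of_mul hy)
      have hout := eq_or_eq_of_ising_prob_ne_zero (right_ne_zero_of_mul hy)
      rw [hstate] at hout
      rw [stateAfter_snoc, decode_snoc]
      obtain ⟨hemit, hstep⟩ | ⟨hemit, hstep⟩ := emit_step_eq_or _ hout
      · simp only [hemit, hstep, List.length_append, List.length_singleton, List.range_succ,
          List.map_append, ← hlist]
        exact ⟨rfl, rfl⟩
      · simp only [hemit, hstep, List.append_nil]
        exact ⟨hlist, rfl⟩

end Decoder

end IsingBelief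

open IsingBelief

/-- The moment generating function of the number of channel uses that the zero-error scheme spends
on the increment `e`: this number is `2` if `e = 0`, and otherwise `1` or `2` with equal
probability. -/
noncomputable def timeMGF {A : Type*} [Zero A] [DecidableEq A] (lam : ℝ) (e : A) : ℝ :=
  if e = 0 then Real.exp lam * Real.exp lam
  else (Real.exp lam + Real.exp lam * Real.exp lam) / 2

section TimeMGF

variable {A : Type*} [Zero A] [DecidableEq A] {lam : ℝ}

theorem timeMGF_pos (lam : ℝ) (e : A) : 0 < timeMGF lam e := by
  unfold timeMGF
  split_ifs <;> positivity

theorem one_le_timeMGF (hlam : 0 ≤ lam) (e : A) : 1 ≤ timeMGF lam e := by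
  have := Real.one_le_exp hlam
  unfold timeMGF
  split_ifs <;> nlinarith

theorem timeMGF_le (lam : ℝ) (e : A) :
    timeMGF lam e ≤ Real.exp (lam * (3 + if e = 0 then 1 else 0) / 2 + lam ^ 2 / 8) := by
  unfold timeMGF
  split_ifs
  · rw [← Real.exp_add]
    exact Real.exp_le_exp.2 (by nlinarith [sq_nonneg lam])
  · have hcosh : (Real.exp lam + Real.exp lam * Real.exp lam) / 2 =
        Real.exp (lam * (3 + 0) / 2) * Real.cosh (lam / 2) := by
      rw [Real.cosh_eq, ← mul_div_assoc, mul_add, ← Real.exp_add, ← Real.exp_add, ← Real.exp_add]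
      ring_nf
    rw [hcosh, Real.exp_add]
    gcongr
    exact (Real.cosh_le_exp_half_sq _).trans_eq (by ring_nf)

theorem prod_timeMGF_pos {ι : Type*} (s : Finset ι) (lam : ℝ) (d : ι → A) :
    0 < ∏ i ∈ s, timeMGF lam (d i) :=
  Finset.prod_pos fun i _ => timeMGF_pos lam (d i)

theorem prod_timeMGF_le {ι : Type*} (s : Finset ι) (lam : ℝ) (d : ι → A) :
    ∏ i ∈ s, timeMGF lam (d i) ≤
      Real.exp (lam * (3 * s.card + (s.filter (d · = 0)).card) / 2 + s.card * (lam ^ 2 / 8)) := by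
  calc ∏ i ∈ s, timeMGF lam (d i)
      ≤ ∏ i ∈ s, Real.exp (lam * (3 + if d i = 0 then 1 else 0) / 2 + lam ^ 2 / 8) :=
        Finset.prod_le_prod (fun _ _ => (timeMGF_pos lam _).le) fun _ _ => timeMGF_le lam _
    _ = _ := by
        rw [← Real.exp_sum, Finset.sum_add_distrib, ← Finset.sum_div, ← Finset.mul_sum,
          Finset.sum_add_distrib, Finset.sum_boole]
        simp only [Finset.sum_const, nsmul_eq_mul]
        ring_nf

end TimeMGF

namespace IsingBelief

variable {A : Type*} [AddGroup A] [DecidableEq A]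

/-- The factor that turns `exp (lam * t)` into a martingale, when `i` increments have been
decoded. -/
noncomputable def timeWeight (lam : ℝ) (d : ℕ → A) : IsingBelief A → ℕ → ℝ
  | known _, i => (∏ l ∈ Finset.range i, timeMGF lam (d l))⁻¹
  | ambiguous _, i => Real.exp lam * (∏ l ∈ Finset.range (i + 1), timeMGF lam (d l))⁻¹

theorem timeWeight_pos (lam : ℝ) (d : ℕ → A) (v : IsingBelief A) (i : ℕ) :
    0 < timeWeight lam d v i := by
  have := prod_timeMGF_pos (Finset.range i) lam d
  have := prod_timeMGF_pos (Finset.range (i + 1)) lam d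
  cases v <;> simp only [timeWeight] <;> positivity

theorem inv_prod_timeMGF_le_timeWeight {lam : ℝ} (hlam : 0 ≤ lam) (d : ℕ → A) (v : IsingBelief A)
    {i k : ℕ} (hik : i < k) :
    (∏ l ∈ Finset.range k, timeMGF lam (d l))⁻¹ ≤ timeWeight lam d v i := by
  have hpos (j : ℕ) : 0 < ∏ l ∈ Finset.range j, timeMGF lam (d l) := prod_timeMGF_pos _ lam d
  have hmono : Monotone fun j => ∏ l ∈ Finset.range j, timeMGF lam (d l) :=
    monotone_nat_of_le_succ fun j => by
      rw [Finset.prod_range_succ]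
      exact le_mul_of_one_le_right (hpos j).le (one_le_timeMGF hlam (d j))
  cases v with
  | known r => exact inv_anti₀ (hpos i) (hmono hik.le)
  | ambiguous r =>
    exact (inv_anti₀ (hpos (i + 1)) (hmono hik)).trans
      (le_mul_of_one_le_left (inv_pos.2 (hpos (i + 1))).le (Real.one_le_exp hlam))

theorem timeWeight_step_add_timeWeight_step (lam : ℝ) (d : ℕ → A) (v : IsingBelief A) (i : ℕ) :
    Real.exp lam * ((timeWeight lam d (v.step (v.base + d i)) (i + (v.emit (v.base + d i)).length) +
      timeWeight lam d (v.step (v.stateOf (d i))) (i + (v.emit (v.stateOf (d i))).length)) / 2) =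
      timeWeight lam d v i := by
  cases v with
  | known r =>
    by_cases he : d i = 0
    · simp only [timeWeight, step, base, he, add_zero, if_true, emit, List.length_nil, timeMGF,
        Finset.prod_range_succ, mul_inv_rev, stateOf, add_self_div_two]
      field_simp
    · simp only [timeWeight, step, base, add_eq_left, he, if_true, if_false, emit,
        neg_add_cancel_left, List.length_singleton, List.length_nil, timeMGF,
        Finset.prod_range_succ, mul_inv_rev, inv_div, stateOf, add_zero]
      field_simp
  | ambiguous r => simp [timeWeight, step, emit, base, stateOf]

variable [Fintype A]

theorem sum_outputProb_send_mul_timeWeight_le (lam : ℝ) (s₀ : A) (d : ℕ → A) (n : ℕ) :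
    ∑ y, (ising A).outputProb s₀ (send s₀ d) n y *
      (Real.exp (lam * n) * timeWeight lam d (decode s₀ n y).1 (decode s₀ n y).2.length) ≤ 1 := by
  refine (sum_outputProb_mul_le_of_supermartingale (ising A) s₀ (send s₀ d)
    (fun t y => Real.exp (lam * t) *
      timeWeight lam d (decode s₀ t y).1 (decode s₀ t y).2.length) (fun t y hy => ?_) n).trans_eq ?_
  · rw [(decode_send s₀ d t y hy).2, sum_ising_prob_mul, decode_snoc, decode_snoc]
    simp only [send, List.length_append]
    rw [← timeWeight_step_add_timeWeight_step lam d (decode s₀ t y).1, Nat.cast_succ, mul_add_one,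
      Real.exp_add]
    exact le_of_eq (by ring)
  · simp [decode, timeWeight]

theorem sum_outputProb_send_length_lt_le {lam : ℝ} (hlam : 0 ≤ lam) (s₀ : A) (d : ℕ → A)
    (k n : ℕ) :
    ∑ y with (decode s₀ n y).2.length < k, (ising A).outputProb s₀ (send s₀ d) n y ≤
      Real.exp (-(lam * n)) * ∏ l ∈ Finset.range k, timeMGF lam (d l) := by
  set P := ∏ l ∈ Finset.range k, timeMGF lam (d l)
  have hP : 0 < P := prod_timeMGF_pos _ lam d
  have hprob (y : Fin n → A) : 0 ≤ (ising A).outputProb s₀ (send s₀ d) n y :=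
    outputProb_nonneg _ _ _ _ y
  have hmarkov : (∑ y with (decode s₀ n y).2.length < k,
      (ising A).outputProb s₀ (send s₀ d) n y) * (Real.exp (lam * n) * P⁻¹) ≤ 1 :=
    calc _ ≤ ∑ y with (decode s₀ n y).2.length < k, (ising A).outputProb s₀ (send s₀ d) n y *
            (Real.exp (lam * n) * timeWeight lam d (decode s₀ n y).1 (decode s₀ n y).2.length) := by
          rw [Finset.sum_mul]
          refine Finset.sum_le_sum fun y hy => ?_
          gcongr
          · exact hprob y
          · exact inv_prod_timeMGF_le_timeWeight hlam d _ (Finset.mem_filter.1 hy).2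
      _ ≤ _ := Finset.sum_le_univ_sum_of_nonneg fun y =>
          mul_nonneg (hprob y) (mul_nonneg (Real.exp_nonneg _) (timeWeight_pos lam d _ _).le)
      _ ≤ 1 := sum_outputProb_send_mul_timeWeight_le lam s₀ d n
  rwa [← le_div_iff₀ (by positivity), one_div, mul_inv, inv_inv, ← Real.exp_neg] at hmarkov

end IsingBelief

end UnifilarFSC

/-! ### Counting words -/

open Polynomial in
theorem card_filter_card_eq {ι A : Type*} [Fintype ι] [DecidableEq ι] [Fintype A] [DecidableEq A]
    (a : A) (j : ℕ) :
    (Finset.univ.filter fun w : ι → A => (Finset.univ.filter fun i => w i = a).card = j).card =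
      (Fintype.card ι).choose j * (Fintype.card A - 1) ^ (Fintype.card ι - j) := by
  have hgen : ∑ w : ι → A, (X : ℕ[X]) ^ (Finset.univ.filter fun i => w i = a).card =
      (X + C (Fintype.card A - 1)) ^ Fintype.card ι :=
    calc _ = ∑ w : ι → A, ∏ i, if w i = a then (X : ℕ[X]) else 1 := by
          simp only [Finset.prod_ite, Finset.prod_const, one_pow, mul_one]
      _ = ∏ _i : ι, ∑ b : A, if b = a then (X : ℕ[X]) else 1 := by
          rw [Finset.prod_univ_sum, Fintype.piFinset_univ]
      _ = (X + C (Fintype.card A - 1)) ^ Fintype.card ι := by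
          rw [Finset.prod_const, Finset.card_univ]
          congr 1
          rw [← Finset.add_sum_erase _ _ (Finset.mem_univ a), if_pos rfl,
            Finset.sum_congr rfl fun b hb => if_neg (Finset.ne_of_mem_erase hb)]
          simp [Finset.card_erase_of_mem]
  have hcoeff := congrArg (coeff · j) hgen
  simp only [finsetSum_coeff, coeff_X_pow, coeff_X_add_C_pow, Finset.sum_boole, Nat.cast_id]
    at hcoeff
  simpa only [eq_comm (a := j), mul_comm] using hcoeff

theorem factorial_mul_pow_le_factorial_mul_pow (a i : ℕ) :
    a.factorial * a ^ i ≤ i.factorial * a ^ a := by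
  rcases le_total a i with h | h
  · calc a.factorial * a ^ i = a.factorial * a ^ (i - a) * a ^ a := by
          rw [mul_assoc, ← pow_add, Nat.sub_add_cancel h]
      _ ≤ _ := Nat.mul_le_mul_right _ (Nat.factorial_mul_pow_sub_le_factorial h)
  · have hfact := Nat.factorial_mul_descFactorial (Nat.sub_le a i)
    rw [Nat.sub_sub_self h] at hfact
    calc a.factorial * a ^ i = i.factorial * (a.descFactorial (a - i) * a ^ i) := by
          rw [← hfact, mul_assoc]
      _ ≤ i.factorial * (a ^ (a - i) * a ^ i) :=
          Nat.mul_le_mul_left _ (Nat.mul_le_mul_right _ (Nat.descFactorial_le_pow _ _))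
      _ = _ := by rw [← pow_add, Nat.sub_add_cancel h]

/-- The mode of the binomial distribution with parameters `k` and `j / k` is `j`. -/
theorem choose_mul_pow_mul_pow_le {k i j : ℕ} (hi : i ≤ k) (hj : j ≤ k) :
    k.choose i * (j ^ i * (k - j) ^ (k - i)) ≤ k.choose j * (j ^ j * (k - j) ^ (k - j)) := by
  have hpos : 0 < j.factorial * (k - j).factorial :=
    Nat.mul_pos (Nat.factorial_pos _) (Nat.factorial_pos _)
  refine Nat.le_of_mul_le_mul_right ?_ hpos
  calc k.choose i * (j ^ i * (k - j) ^ (k - i)) * (j.factorial * (k - j).factorial)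
      = k.choose i * ((j.factorial * j ^ i) * ((k - j).factorial * (k - j) ^ (k - i))) := by ring
    _ ≤ k.choose i * ((i.factorial * j ^ j) * ((k - i).factorial * (k - j) ^ (k - j))) :=
        Nat.mul_le_mul_left _ (Nat.mul_le_mul (factorial_mul_pow_le_factorial_mul_pow _ _)
          (factorial_mul_pow_le_factorial_mul_pow _ _))
    _ = (k.choose i * i.factorial * (k - i).factorial) * (j ^ j * (k - j) ^ (k - j)) := by ring
    _ = (k.choose j * j.factorial * (k - j).factorial) * (j ^ j * (k - j) ^ (k - j)) := by
        rw [Nat.choose_mul_factorial_mul_factorial hi, Nat.choose_mul_factorial_mul_factorial hj]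
    _ = _ := by ring

theorem pow_self_le_succ_mul_choose {k j : ℕ} (hj : j ≤ k) :
    k ^ k ≤ (k + 1) * (k.choose j * (j ^ j * (k - j) ^ (k - j))) := by
  calc k ^ k = (j + (k - j)) ^ k := by rw [Nat.add_sub_cancel' hj]
    _ = ∑ i ∈ Finset.range (k + 1), k.choose i * (j ^ i * (k - j) ^ (k - i)) := by
        rw [add_pow]
        exact Finset.sum_congr rfl fun i _ => mul_comm _ _
    _ ≤ ∑ _i ∈ Finset.range (k + 1), k.choose j * (j ^ j * (k - j) ^ (k - j)) :=
        Finset.sum_le_sum fun i hi =>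
          choose_mul_pow_mul_pow_le (Nat.lt_succ_iff.1 (Finset.mem_range.1 hi)) hj
    _ = _ := by rw [Finset.sum_const, Finset.card_range, smul_eq_mul]

theorem mul_binEntropy_div {x y : ℝ} (hx : x ≠ 0) (hy : y ≠ 0) (hyx : x - y ≠ 0) :
    x * Real.binEntropy (y / x) =
      x * Real.log x - y * Real.log y - (x - y) * Real.log (x - y) := by
  rw [Real.binEntropy, one_sub_div hx, Real.log_inv, Real.log_inv, Real.log_div hy hx,
    Real.log_div hyx hx]
  field_simp
  ring

theorem mul_binEntropy_le_log_choose {k j : ℕ} (hj0 : 0 < j) (hj : j < k) :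
    k * Real.binEntropy (j / k) - Real.log (k + 1) ≤ Real.log (k.choose j) := by
  have hk : (0 : ℝ) < k := by exact_mod_cast hj0.trans hj
  have hj0' : (0 : ℝ) < j := by exact_mod_cast hj0
  have hkj : (0 : ℝ) < k - j := sub_pos.2 (by exact_mod_cast hj)
  have hchoose : (0 : ℝ) < k.choose j := by exact_mod_cast Nat.choose_pos hj.le
  have hpow : (k : ℝ) ^ k ≤ (k + 1) * (k.choose j * (j ^ j * (k - j : ℝ) ^ (k - j))) := by
    rw [← Nat.cast_sub hj.le]
    exact_mod_cast pow_self_le_succ_mul_choose hj.le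
  have hlog := Real.log_le_log (by positivity) hpow
  rw [Real.log_mul (by positivity) (by positivity), Real.log_mul (by positivity) (by positivity),
    Real.log_mul (by positivity) (by positivity), Real.log_pow, Real.log_pow, Real.log_pow,
    Nat.cast_sub hj.le] at hlog
  rw [mul_binEntropy_div hk.ne' hj0'.ne' hkj.ne']
  linarith

/-! ### Achievability -/

namespace UnifilarFSC

section Achievability

variable {A : Type*} [AddGroup A] [Fintype A] [DecidableEq A]

open IsingBelief

theorem sum_outputProb_send_take_ne_le {lam : ℝ} (hlam : 0 ≤ lam) (s₀ : A) (d : ℕ → A)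
    (k n : ℕ) :
    ∑ y with (decode s₀ n y).2.take k ≠ (List.range k).map d,
        (ising A).outputProb s₀ (send s₀ d) n y ≤
      Real.exp (-(lam * n)) * ∏ l ∈ Finset.range k, timeMGF lam (d l) := by
  refine le_trans ?_ (sum_outputProb_send_length_lt_le hlam s₀ d k n)
  rw [← Finset.sum_filter_ne_zero]
  refine Finset.sum_le_sum_of_subset_of_nonneg (fun y => ?_) fun y _ _ =>
    outputProb_nonneg _ _ _ _ y
  simp only [Finset.mem_filter, Finset.mem_univ, true_and]
  rintro ⟨hne, hprob⟩
  contrapose! hne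
  rw [(decode_send s₀ d n y hprob).1, ← List.map_take, List.take_range, min_eq_left hne]

theorem exists_code_of_injective {M n k : ℕ} [NeZero M] {w : Fin M → Fin k → A}
    (hw : Function.Injective w) {lam B : ℝ} (hlam : 0 ≤ lam)
    (hB : ∀ m, ∏ i, timeMGF lam (w m i) ≤ B) (s₀ : A) :
    ∃ c : FeedbackCode A A M n, (ising A).errorProb s₀ c ≤ Real.exp (-(lam * n)) * B := by
  let d (m : Fin M) : ℕ → A := Function.extend Fin.val (w m) 0
  have hd (m : Fin M) (i : Fin k) : d m i = w m i := Fin.val_injective.extend_apply _ _ i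
  have hlist (m : Fin M) : (List.range k).map (d m) = List.ofFn (w m) :=
    List.ext_getElem (by simp) fun i _ hi => by simpa using hd m ⟨i, by simpa using hi⟩
  have hinj : Function.Injective fun m => List.ofFn (w m) := List.ofFn_injective.comp hw
  refine ⟨⟨fun m => send s₀ (d m), fun y =>
    Function.invFun (fun m => List.ofFn (w m)) ((decode s₀ n y).2.take k)⟩,
    errorProb_le_of_forall _ _ _ (NeZero.pos M) fun m => ?_⟩
  calc _ ≤ ∑ y with (decode s₀ n y).2.take k ≠ (List.range k).map (d m),
          (ising A).outputProb s₀ (send s₀ (d m)) n y := by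
        refine Finset.sum_le_sum_of_subset_of_nonneg (fun y => ?_) fun y _ _ =>
          outputProb_nonneg _ _ _ _ y
        rw [Finset.mem_filter_univ, Finset.mem_filter_univ, hlist]
        contrapose!
        intro hy
        exact (congrArg _ hy).trans (Function.leftInverse_invFun hinj m)
    _ ≤ Real.exp (-(lam * n)) * ∏ l ∈ Finset.range k, timeMGF lam (d m l) :=
        sum_outputProb_send_take_ne_le hlam s₀ (d m) k n
    _ ≤ Real.exp (-(lam * n)) * B := by
        rw [Finset.prod_range]
        simp only [hd]
        gcongr
        exact hB m

theorem exists_code_of_le_choose_mul_pow {M n k j : ℕ} [NeZero M]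
    (hM : M ≤ k.choose j * (Fintype.card A - 1) ^ (k - j)) {lam : ℝ} (hlam : 0 ≤ lam) (s₀ : A) :
    ∃ c : FeedbackCode A A M n, (ising A).errorProb s₀ c ≤
      Real.exp (lam * ((3 * k + j) / 2 - n) + k * (lam ^ 2 / 8)) := by
  let W := {w : Fin k → A // (Finset.univ.filter fun i => w i = 0).card = j}
  obtain ⟨w⟩ : Nonempty (Fin M ↪ W) := Function.Embedding.nonempty_of_card_le <| by
    rwa [Fintype.card_fin, Fintype.card_subtype, card_filter_card_eq, Fintype.card_fin]
  have hprod (m : Fin M) : ∏ i, timeMGF lam ((w m).1 i) ≤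
      Real.exp (lam * (3 * k + j) / 2 + k * (lam ^ 2 / 8)) := by
    simpa only [(w m).2, Finset.card_fin] using prod_timeMGF_le Finset.univ lam (w m).1
  obtain ⟨c, hc⟩ := exists_code_of_injective (n := n) (w := fun m => (w m).1)
    (Subtype.val_injective.comp w.injective) hlam hprod s₀
  refine ⟨c, hc.trans_eq ?_⟩
  rw [← Real.exp_add]
  ring_nf

end Achievability

end UnifilarFSC

theorem tendsto_log_succ_div {k : ℕ → ℕ} {a : ℝ} (hk : Tendsto k atTop atTop)
    (hka : Tendsto (fun n => (k n : ℝ) / n) atTop (𝓝 a)) :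
    Tendsto (fun n => Real.log (k n + 1) / n) atTop (𝓝 0) := by
  have hlog : Tendsto (fun x : ℝ => Real.log x / x) atTop (𝓝 0) := by
    simpa using Real.isLittleO_log_id_atTop.tendsto_div_nhds_zero
  have hk1 : Tendsto (fun n => (k n : ℝ) + 1) atTop atTop :=
    tendsto_atTop_add_const_right _ _ (tendsto_natCast_atTop_atTop.comp hk)
  have hk1a : Tendsto (fun n => ((k n : ℝ) + 1) / n) atTop (𝓝 a) := by
    simpa [add_div] using hka.add tendsto_one_div_atTop_nhds_zero_nat
  have hprod := (hlog.comp hk1).mul hk1a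
  rw [zero_mul] at hprod
  exact hprod.congr fun n => div_mul_div_cancel₀ (by positivity)

theorem eventually_rpow_le_choose_mul_pow {k j : ℕ → ℕ} {a p R : ℝ} {m : ℕ} (hm : 0 < m)
    (hp0 : 0 < p) (hp1 : p < 1) (hk : Tendsto k atTop atTop)
    (hka : Tendsto (fun n => (k n : ℝ) / n) atTop (𝓝 a))
    (hjk : Tendsto (fun n => (j n : ℝ) / k n) atTop (𝓝 p))
    (hR : R * Real.log 2 < a * (Real.binEntropy p + (1 - p) * Real.log m)) :
    ∀ᶠ n : ℕ in atTop, (2 : ℝ) ^ (n * R) ≤ (k n).choose (j n) * (m : ℝ) ^ (k n - j n) := by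
  have hlim := (hka.mul (((Real.binEntropy_continuous.tendsto p).comp hjk).add
    ((tendsto_const_nhds (x := (1 : ℝ)).sub hjk).mul_const (Real.log m)))).sub
    (tendsto_log_succ_div hk hka)
  rw [sub_zero] at hlim
  filter_upwards [hlim.eventually_const_lt hR, eventually_gt_atTop 0,
    hjk.eventually_const_lt hp0, hjk.eventually_lt_const hp1, hk.eventually_gt_atTop 0]
    with n hrate hn hj0 hj1 hk0
  have hn' : (0 : ℝ) < n := Nat.cast_pos.2 hn
  have hk0' : (0 : ℝ) < k n := Nat.cast_pos.2 hk0
  have hjpos : 0 < j n := by exact_mod_cast (div_pos_iff_of_pos_right hk0').1 hj0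
  have hjlt : j n < k n := by exact_mod_cast (div_lt_one hk0').1 hj1
  have hchoose : (0 : ℝ) < (k n).choose (j n) := Nat.cast_pos.2 (Nat.choose_pos hjlt.le)
  have : (0 : ℝ) < m := Nat.cast_pos.2 hm
  rw [← Real.log_le_log_iff (by positivity) (by positivity), Real.log_rpow two_pos,
    Real.log_mul hchoose.ne' (by positivity), Real.log_pow, Nat.cast_sub hjlt.le]
  calc n * R * Real.log 2
      ≤ n * (k n / n * (Real.binEntropy (j n / k n) + (1 - j n / k n) * Real.log m) -
          Real.log (k n + 1) / n) := by
        rw [mul_assoc]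
        exact mul_le_mul_of_nonneg_left hrate.le hn'.le
    _ = k n * Real.binEntropy (j n / k n) - Real.log (k n + 1) + (k n - j n) * Real.log m := by
        field_simp
        ring
    _ ≤ Real.log ((k n).choose (j n)) + (k n - j n) * Real.log m := by
        gcongr
        exact mul_binEntropy_le_log_choose hjpos hjlt

theorem chernoff_exponent_le {ε p n k j : ℝ} (hε : 0 ≤ ε) (hp : 0 ≤ p) (hn : 0 ≤ n)
    (hk : k ≤ (1 - ε) * (2 / (3 + p)) * n) (hj : j ≤ p * k) :
    ε * ((3 * k + j) / 2 - n) + k * (ε ^ 2 / 8) ≤ -(7 / 8 * ε ^ 2) * n := by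
  have htime : (3 * k + j) / 2 ≤ (1 - ε) * n :=
    calc (3 * k + j) / 2 ≤ (3 + p) / 2 * k := by linarith
      _ ≤ (3 + p) / 2 * ((1 - ε) * (2 / (3 + p)) * n) := by gcongr
      _ = (1 - ε) * n := by field_simp
  have hkn : k ≤ n := by
    refine hk.trans (mul_le_of_le_one_left hn ?_)
    rw [← mul_div_assoc, div_le_one (by positivity)]
    linarith
  calc ε * ((3 * k + j) / 2 - n) + k * (ε ^ 2 / 8)
      ≤ ε * ((1 - ε) * n - n) + n * (ε ^ 2 / 8) := by gcongr
    _ = -(7 / 8 * ε ^ 2) * n := by ring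

namespace UnifilarFSC

theorem isAchievable_of_lt_isingRate {A : Type*} [AddGroup A] [Fintype A] [DecidableEq A]
    [Nontrivial A] {p R : ℝ} (hp0 : 0 < p) (hp1 : p < 1) (s₀ : A)
    (hR : R < isingRate (Fintype.card A) p) : (ising A).IsAchievable s₀ R := by
  obtain ⟨ε, hε0, hε1, hRε⟩ :
      ∃ ε : ℝ, 0 < ε ∧ ε < 1 ∧ R < (1 - ε) * isingRate (Fintype.card A) p := by
    have hpos : 0 < isingRate (Fintype.card A) p :=
      isingRate_pos (by exact_mod_cast Fintype.one_lt_card (α := A)) hp0 hp1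
    obtain ⟨x, hRx, hx1⟩ := exists_between (max_lt ((div_lt_one hpos).2 hR) one_pos)
    obtain ⟨hRx, hx0⟩ := max_lt_iff.1 hRx
    refine ⟨1 - x, by linarith, by linarith, ?_⟩
    rwa [sub_sub_cancel, ← div_lt_iff₀ hpos]
  set a := (1 - ε) * (2 / (3 + p))
  have ha0 : 0 < a := mul_pos (sub_pos.2 hε1) (by positivity)
  let k (n : ℕ) : ℕ := ⌊a * n⌋₊
  let j (n : ℕ) : ℕ := ⌊p * k n⌋₊
  have hk : Tendsto k atTop atTop :=
    tendsto_nat_floor_atTop.comp (tendsto_natCast_atTop_atTop.const_mul_atTop ha0)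
  have hka : Tendsto (fun n => (k n : ℝ) / n) atTop (𝓝 a) :=
    (tendsto_nat_floor_mul_div_atTop ha0.le).comp tendsto_natCast_atTop_atTop
  have hjk : Tendsto (fun n => (j n : ℝ) / k n) atTop (𝓝 p) :=
    (tendsto_nat_floor_mul_div_atTop hp0.le).comp (tendsto_natCast_atTop_atTop.comp hk)
  have hrate : R * Real.log 2 <
      a * (Real.binEntropy p + (1 - p) * Real.log ((Fintype.card A - 1 : ℕ) : ℝ)) := by
    rw [isingRate_eq_div_log_two, ← mul_div_assoc, lt_div_iff₀ (Real.log_pos one_lt_two)] at hRε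
    rw [Nat.cast_pred Fintype.card_pos]
    convert! hRε using 1
    ring
  have hε : Tendsto (fun n : ℕ => Real.exp (-(7 / 8 * ε ^ 2) * n)) atTop (𝓝 0) :=
    Real.tendsto_exp_atBot.comp
      (tendsto_natCast_atTop_atTop.const_mul_atTop_of_neg (neg_neg_of_pos (by positivity)))
  refine isAchievable_of_eventually hε ?_
  filter_upwards [eventually_rpow_le_choose_mul_pow (Nat.sub_pos_of_lt Fintype.one_lt_card)
    hp0 hp1 hk hka hjk hrate] with n hn
  have : NeZero ⌈(2 : ℝ) ^ ((n : ℝ) * R)⌉₊ := ⟨(Nat.ceil_pos.2 (by positivity)).ne'⟩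
  obtain ⟨c, hc⟩ := exists_code_of_le_choose_mul_pow (n := n)
    (Nat.ceil_le.2 (by exact_mod_cast hn)) hε0.le s₀
  exact ⟨c, hc.trans (Real.exp_le_exp.2 (chernoff_exponent_le hε0.le hp0.le n.cast_nonneg
    (Nat.floor_le (by positivity)) (Nat.floor_le (by positivity))))⟩

end UnifilarFSC

/-! ### The feedback capacity -/

open UnifilarFSC in
theorem isFeedbackCapacity_ising {A : Type*} [Fintype A] [DecidableEq A] [Nontrivial A]
    (hA : Fintype.card A ≤ 8) {p : ℝ} (hp : IsOptimalParam (Fintype.card A) p) (s₀ : A) :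
    (ising A).IsFeedbackCapacity s₀ (isingRate (Fintype.card A) p) := by
  have : NeZero (Fintype.card A) := ⟨Fintype.card_ne_zero⟩
  -- the coding scheme subtracts symbols; any group structure on the alphabet will do
  let : AddGroup A := (Fintype.equivFin A).addGroup
  refine ⟨fun R hR => hR.le_isingRate hA hp, fun b hb => ?_⟩
  by_contra! hlt
  obtain ⟨R, hbR, hR⟩ := exists_between hlt
  exact (hb (isAchievable_of_lt_isingRate hp.pos hp.lt_one s₀ hR)).not_gt hbR

theorem theorem2_general {A : Type*} [Fintype A] [DecidableEq A] [Nontrivial A]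
    (hA : Fintype.card A ≤ 8) :
    ∃ p, IsOptimalParam (Fintype.card A) p ∧
      IsGreatest (isingRate (Fintype.card A) '' Set.Icc 0 1) (isingRate (Fintype.card A) p) ∧
      ∀ s₀ : A, (UnifilarFSC.ising A).IsFeedbackCapacity s₀ (isingRate (Fintype.card A) p) := by
  obtain ⟨p, hp⟩ := exists_isOptimalParam (q := Fintype.card A)
    (by exact_mod_cast (Fintype.one_lt_card (α := A)).ne')
  exact ⟨p, hp, hp.isGreatest, isFeedbackCapacity_ising hA hp⟩

theorem theorem2 :
    ∃ C : ℝ,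
      (∀ s₀ : Fin 3, (UnifilarFSC.ising (Fin 3)).IsFeedbackCapacity s₀ C) ∧
      IsGreatest (ising3Rate '' Set.Icc (0 : ℝ) 1) C ∧
      |C - 0.961227| ≤ 5e-7 ∧
      ∃ p ∈ Set.Icc (0 : ℝ) 1, ising3Rate p = C ∧ |p - 0.263805| ≤ 5e-7 := by
  obtain ⟨p, hp, hmax, hcap⟩ := theorem2_general (A := Fin 3) (by simp)
  rw [Fintype.card_fin, Nat.cast_ofNat] at hp
  rw [Fintype.card_fin, Nat.cast_ofNat, isingRate_three] at hmax hcap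
  exact ⟨ising3Rate p, hcap, hmax, hp.abs_ising3Rate_sub_le, p, ⟨hp.pos.le, hp.lt_one.le⟩, rfl,
    hp.abs_sub_le_of_three⟩
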